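/- For a measurable set $E\subset\mathbb R$ let $P_E$ be the operator on $L^2(\mathbb R)$ given by $P_Ef=f\chi_E$, and let $Q_E=\mathcal F^{-1}P_E\mathcal F$, where $\mathcal F f(\xi)=\int_{\mathbb R}f(x)e^{-2\pi i x\xi}\,dx$ is the (unitary) Fourier transform on $L^2(\mathbb R)$. For intervals $T,\Omega\subset\mathbb R$ with $|T|\,|\Omega|=c\in(0,\infty)$, the operator $P_TQ_\Omega P_T$ is compact, self-adjoint and non-negative; let $\lambda_1(c)\ge\lambda_2(c)\ge\dots$ be its positive eigenvalues in decreasing order, counted with multiplicity (they depend only on the product $c=|T|\,|\Omega|$). For every $0<\varepsilon<1$ there is a constant $\delta=\delta(\varepsilon)$ with $0<\delta<1$ such that for all sufficiently large $c$ (how large depends only on $\varepsilon$) and all intervals $T,\Omega$ with $|T|\,|\Omega|=c$, $$\lambda_n(c)\ge 1-\delta^{c},\qquad\text{where } n=[(1-\varepsilon)c]$$ and $[t]$ denotes the integer part of $t$. -/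

import Mathlib

open MeasureTheory

/-- The complex Hilbert space `L²(ℝ)`. -/
abbrev L2R : Type := Lp (α := ℝ) ℂ 2 (volume : Measure ℝ)

/-- The class in `L²(ℝ)` of the truncated function `f χ_T`, for a measurable set `T`. -/
noncomputable def truncate {T : Set ℝ} (hT : MeasurableSet T) (f : L2R) : L2R :=
  MemLp.toLp (T.indicator (f : ℝ → ℂ)) ((Lp.memLp f).indicator hT)

theorem truncate_coeFn {T : Set ℝ} (hT : MeasurableSet T) (f : L2R) :
    (truncate hT f : ℝ → ℂ) =ᵐ[volume] T.indicator (f : ℝ → ℂ) :=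
  MemLp.coeFn_toLp _

theorem truncate_add {T : Set ℝ} (hT : MeasurableSet T) (f g : L2R) :
    truncate hT (f + g) = truncate hT f + truncate hT g := by
  refine Lp.ext ?_
  filter_upwards [truncate_coeFn hT (f + g), truncate_coeFn hT f, truncate_coeFn hT g,
    Lp.coeFn_add f g, Lp.coeFn_add (truncate hT f) (truncate hT g)] with x h1 h2 h3 h4 h5
  rw [h1, h5, Pi.add_apply, h2, h3]
  by_cases hx : x ∈ T
  · simp only [Set.indicator_of_mem hx, h4, Pi.add_apply]
  · simp only [Set.indicator_of_notMem hx, add_zero]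

theorem truncate_smul {T : Set ℝ} (hT : MeasurableSet T) (a : ℂ) (f : L2R) :
    truncate hT (a • f) = a • truncate hT f := by
  refine Lp.ext ?_
  filter_upwards [truncate_coeFn hT (a • f), truncate_coeFn hT f,
    Lp.coeFn_smul a f, Lp.coeFn_smul a (truncate hT f)] with x h1 h2 h3 h4
  rw [h1, h4, Pi.smul_apply, h2]
  by_cases hx : x ∈ T
  · simp only [Set.indicator_of_mem hx, h3, Pi.smul_apply]
  · simp only [Set.indicator_of_notMem hx, smul_zero]

theorem norm_truncate_le {T : Set ℝ} (hT : MeasurableSet T) (f : L2R) :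
    ‖truncate hT f‖ ≤ 1 * ‖f‖ := by
  rw [one_mul]
  refine Lp.norm_le_norm_of_ae_le ?_
  filter_upwards [truncate_coeFn hT f] with x hx
  rw [hx]
  exact norm_indicator_le_norm_self _ _

/-- The time projection `P_T f = f χ_T` as a bounded operator on `L²(ℝ)`. -/
noncomputable def timeProj {T : Set ℝ} (hT : MeasurableSet T) : L2R →L[ℂ] L2R :=
  LinearMap.mkContinuous
    { toFun := truncate hT
      map_add' := truncate_add hT
      map_smul' := truncate_smul hT }
    1 (norm_truncate_le hT)

/-- The `L²` Fourier transform, normalized by `𝓕 f (ξ) = ∫ f(x) exp (-2πi x ξ) dx`,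
as a bounded operator. -/
noncomputable def fourierL2 : L2R →L[ℂ] L2R :=
  (Lp.fourierTransformₗᵢ ℝ ℂ).toContinuousLinearEquiv.toContinuousLinearMap

/-- The inverse Fourier transform on `L²(ℝ)`. -/
noncomputable def fourierInvL2 : L2R →L[ℂ] L2R :=
  (Lp.fourierTransformₗᵢ ℝ ℂ).symm.toContinuousLinearEquiv.toContinuousLinearMap

/-- The frequency projection `Q_Ω = 𝓕⁻¹ P_Ω 𝓕`. -/
noncomputable def freqProj {Ω : Set ℝ} (hΩ : MeasurableSet Ω) : L2R →L[ℂ] L2R :=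
  fourierInvL2 ∘L timeProj hΩ ∘L fourierL2

/-- The time-frequency localization operator `S_{T,Ω} = P_T Q_Ω P_T`. -/
noncomputable def timeFreqOp {T Ω : Set ℝ} (hT : MeasurableSet T) (hΩ : MeasurableSet Ω) :
    L2R →L[ℂ] L2R :=
  timeProj hT ∘L freqProj hΩ ∘L timeProj hT

/-- The `n`-th largest eigenvalue (`n = 1, 2, …`, counted with multiplicity) of a compact
non-negative self-adjoint operator `S`: the largest eigenvalue `μ` such that the eigenvectors
for the eigenvalues `≥ μ` span a space of dimension at least `n`. -/
noncomputable def nthEigenvalue {H : Type*} [NormedAddCommGroup H] [InnerProductSpace ℂ H]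
    (S : H →L[ℂ] H) (n : ℕ) : ℝ :=
  sSup {μ : ℝ | Module.End.HasEigenvalue (S : H →ₗ[ℂ] H) (μ : ℂ) ∧
    (n : Cardinal) ≤ Module.rank ℂ
      (⨆ ν : Set.Ici μ, Module.End.eigenspace (S : H →ₗ[ℂ] H) ((ν : ℝ) : ℂ) : Submodule ℂ H)}

/-!
By the Courant–Fischer principle (`le_nthEigenvalue`) it is enough to find an `n`-dimensional space
of functions `f` supported in `T` for which `‖𝓕 f‖²` outside `Ω` is at most `δ ^ c ‖f‖²`. That
principle rests on the spectral theorem for compact self-adjoint operators; compactness of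
`P_T Q_Ω P_T` holds because on `T × Ω` the kernel `exp (-2πi x ξ)` is a uniform limit of its Taylor
polynomials, so `P_Ω 𝓕 P_T` is a norm limit of operators of finite rank
(`isCompactOperator_timeProj_fourierL2_timeProj`).

The trial functions are modulated windows `exp (2πi (ν + k / L) x) g x`, `k < n`. The window `g` is
supported in `T` and equal to `1` on a subinterval of length `L = (1 - ε / 2) |T|`, on which the
exponentials are orthogonal; so the `L²` norm of a combination with coefficients `a k` is at least
`(L ∑ ‖a k‖²) ^ (1 / 2)` (`mul_sum_sq_le_norm_sq`). The `n ≤ (1 - ε) |T| |Ω|` frequencies fit into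
`Ω` with a margin `ε |Ω| / 4` on both sides, so all that is needed is that `𝓕 g` is exponentially
small, in `L²`, at distance at least `ε |Ω| / 4` from the origin.

To that end `g` is a bump function averaged `m` times over intervals of length
`w = 4 / (ε |Ω|)` (`exists_window`). Each average multiplies the Fourier transform by a factor of
size at most `1 / (π w |ξ|) ≤ 1 / 2` in the relevant range, and enlarges the support by only
`w / 2` on each side. The gap between plateau and support has length proportional to `ε |T|`, which
leaves room for `m` proportional to `ε² c` averages, and Plancherel's identity for the bump gives
the total loss `(1 / 4) ^ m (2 c)`, which is below `δ ^ c` for large `c`.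
-/

/-! ### The min-max bound -/

section MinMax

open Module.End

variable {H : Type*} [NormedAddCommGroup H] [InnerProductSpace ℂ H]

/-- A vector in the span of the eigenspaces for real eigenvalues `< μ` has Rayleigh quotient at
most `μ`. -/
theorem re_inner_le_of_mem_iSup_eigenspace {S : H →L[ℂ] H}
    (hS : (S : H →ₗ[ℂ] H).IsSymmetric) {μ : ℝ} {g : H}
    (hg : g ∈ (⨆ ν : Set.Iio μ, eigenspace (S : H →ₗ[ℂ] H) ((ν : ℝ) : ℂ) : Submodule ℂ H)) :
    (inner ℂ (S g) g).re ≤ μ * ‖g‖ ^ 2 := by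
  classical
  obtain ⟨f, hf, rfl⟩ := (Submodule.mem_iSup_iff_exists_finsupp _ _).1 hg
  have horth : OrthogonalFamily ℂ
      (fun ν : Set.Iio μ => eigenspace (S : H →ₗ[ℂ] H) ((ν : ℝ) : ℂ))
      (fun ν => (eigenspace (S : H →ₗ[ℂ] H) ((ν : ℝ) : ℂ)).subtypeₗᵢ) :=
    hS.orthogonalFamily_eigenspaces.comp
      (Complex.ofReal_injective.comp Subtype.coe_injective)
  let l : ∀ ν : Set.Iio μ, eigenspace (S : H →ₗ[ℂ] H) ((ν : ℝ) : ℂ) := fun ν => ⟨f ν, hf ν⟩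
  have h1 : (f.sum fun _ x => x) = ∑ ν ∈ f.support,
      (eigenspace (S : H →ₗ[ℂ] H) ((ν : ℝ) : ℂ)).subtypeₗᵢ (l ν) := rfl
  have h2 : S (f.sum fun _ x => x) = ∑ ν ∈ f.support,
      (eigenspace (S : H →ₗ[ℂ] H) ((ν : ℝ) : ℂ)).subtypeₗᵢ ((((ν : ℝ) : ℂ)) • l ν) := by
    rw [Finsupp.sum, map_sum]
    exact Finset.sum_congr rfl fun ν _ => mem_eigenspace_iff.1 (hf ν)
  rw [h2, h1, horth.inner_sum, horth.norm_sum, Complex.re_sum, Finset.mul_sum]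
  refine Finset.sum_le_sum fun ν _ => ?_
  rw [inner_smul_left, Complex.conj_ofReal, inner_self_eq_norm_sq_to_K]
  have : (((ν : ℝ) : ℂ) * ((‖l ν‖ : ℝ) : ℂ) ^ 2).re = (ν : ℝ) * ‖l ν‖ ^ 2 := by
    rw [← Complex.ofReal_pow, ← Complex.ofReal_mul, Complex.ofReal_re]
  exact this.trans_le (mul_le_mul_of_nonneg_right (le_of_lt ν.2) (sq_nonneg _))

/-- By the spectral theorem, a vector orthogonal to all eigenspaces for eigenvalues `≥ μ` is a
limit of combinations of eigenvectors for eigenvalues `< μ`. -/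
theorem re_inner_le_of_mem_orthogonal [CompleteSpace H] {S : H →L[ℂ] H} (hc : IsCompactOperator S)
    (hS : (S : H →ₗ[ℂ] H).IsSymmetric) {μ : ℝ} {f : H}
    (hf : f ∈ (⨆ ν : Set.Ici μ, eigenspace (S : H →ₗ[ℂ] H) ((ν : ℝ) : ℂ) : Submodule ℂ H)ᗮ) :
    (inner ℂ (S f) f).re ≤ μ * ‖f‖ ^ 2 := by
  set W := (⨆ ν : Set.Ici μ, eigenspace (S : H →ₗ[ℂ] H) ((ν : ℝ) : ℂ) : Submodule ℂ H)
  set U := (⨆ ν : Set.Iio μ, eigenspace (S : H →ₗ[ℂ] H) ((ν : ℝ) : ℂ) : Submodule ℂ H)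
  have hUW : U ≤ Wᗮ := by
    refine iSup_le fun ν => ?_
    rw [← Submodule.iInf_orthogonal, le_iInf_iff]
    intro ν'
    have hne : ((ν : ℝ) : ℂ) ≠ ((ν' : ℝ) : ℂ) := fun h =>
      (lt_of_lt_of_le ν.2 ν'.2).ne (Complex.ofReal_injective h)
    intro x hx y hy
    exact hS.orthogonalFamily_eigenspaces hne.symm ⟨y, hy⟩ ⟨x, hx⟩
  have htop : ((⨆ ν : ℂ, eigenspace (S : H →ₗ[ℂ] H) ν : Submodule ℂ H)) ≤ W ⊔ U := by
    refine iSup_le fun ν => ?_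
    by_cases h : HasEigenvalue (S : H →ₗ[ℂ] H) ν
    · obtain ⟨r, hr⟩ := Complex.conj_eq_iff_real.1 (hS.conj_eigenvalue_eq_self h)
      subst hr
      rcases le_or_gt μ r with hr | hr
      · exact le_sup_of_le_left (le_iSup (fun ν : Set.Ici μ =>
          eigenspace (S : H →ₗ[ℂ] H) ((ν : ℝ) : ℂ)) ⟨r, hr⟩)
      · exact le_sup_of_le_right (le_iSup (fun ν : Set.Iio μ =>
          eigenspace (S : H →ₗ[ℂ] H) ((ν : ℝ) : ℂ)) ⟨r, hr⟩)
    · rw [HasEigenvalue, HasUnifEigenvalue, not_not] at h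
      exact h.trans_le bot_le
  have hbot : (W ⊔ U)ᗮ = ⊥ := by
    rw [eq_bot_iff, ← ContinuousLinearMap.orthogonalComplement_iSup_eigenspaces_eq_bot hc hS]
    exact Submodule.orthogonal_le htop
  have hfU : f ∈ U.topologicalClosure := by
    rw [← Submodule.orthogonal_orthogonal_eq_closure]
    have hUo : Wᗮ ⊓ Uᗮ = ⊥ := by rw [Submodule.inf_orthogonal, hbot]
    obtain ⟨y, hy, z, hz, rfl⟩ := Uᗮ.exists_add_mem_mem_orthogonal f
    have hzW : z ∈ Wᗮ := by
      rw [Submodule.orthogonal_orthogonal_eq_closure] at hz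
      exact Submodule.topologicalClosure_minimal _ hUW (Submodule.isClosed_orthogonal W) hz
    have hyW : y ∈ Wᗮ := by simpa using Submodule.sub_mem _ hf hzW
    have : y ∈ (⊥ : Submodule ℂ H) := hUo ▸ ⟨hyW, hy⟩
    rw [(Submodule.mem_bot ℂ).1 this, zero_add]
    exact hz
  have hclosed : IsClosed {g : H | (inner ℂ (S g) g).re ≤ μ * ‖g‖ ^ 2} := by
    refine isClosed_le ?_ (by fun_prop)
    exact Complex.continuous_re.comp (S.continuous.inner continuous_id)
  exact closure_minimal (s := (U : Set H))
    (fun g hg => re_inner_le_of_mem_iSup_eigenspace hS hg) hclosed hfU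

/-- If the eigenvectors for eigenvalues `≥ μ` span at least `n > 0` dimensions, some eigenvalue
`ν ≥ μ` is a member of the set whose supremum is `nthEigenvalue S n`. -/
theorem exists_hasEigenvalue_rank_le {S : H →L[ℂ] H} {n : ℕ} (hn : 0 < n) {μ : ℝ}
    (hr : (n : Cardinal) ≤ Module.rank ℂ
      (⨆ ν : Set.Ici μ, eigenspace (S : H →ₗ[ℂ] H) ((ν : ℝ) : ℂ) : Submodule ℂ H)) :
    ∃ ν : ℝ, μ ≤ ν ∧ HasEigenvalue (S : H →ₗ[ℂ] H) (ν : ℂ) ∧ (n : Cardinal) ≤ Module.rank ℂ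
      (⨆ κ : Set.Ici ν, eigenspace (S : H →ₗ[ℂ] H) ((κ : ℝ) : ℂ) : Submodule ℂ H) := by
  classical
  set W := (⨆ ν : Set.Ici μ, eigenspace (S : H →ₗ[ℂ] H) ((ν : ℝ) : ℂ) : Submodule ℂ H)
  -- `n` independent vectors involve only finitely many eigenvalues; the smallest of them will do.
  obtain ⟨v, hv⟩ := Module.le_rank_iff.1 hr
  choose f hf hsum using fun i => (Submodule.mem_iSup_iff_exists_finsupp _ _).1 (v i).2
  set t : Finset ℝ := Finset.univ.biUnion fun i => (f i).support.image Subtype.val with ht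
  have ht_mem : ∀ i, ∀ κ ∈ (f i).support, (κ : ℝ) ∈ t := fun i κ hκ =>
    Finset.mem_biUnion.2 ⟨i, Finset.mem_univ _, Finset.mem_image_of_mem _ hκ⟩
  have hne : t.Nonempty := by
    have h0 : (f ⟨0, hn⟩).support.Nonempty := by
      rw [Finsupp.support_nonempty_iff]
      intro h
      refine hv.ne_zero ⟨0, hn⟩ (Subtype.ext ?_)
      rw [← hsum, h, Finsupp.sum_zero_index, Submodule.coe_zero]
    exact h0.elim fun κ hκ => ⟨κ, ht_mem _ κ hκ⟩
  obtain ⟨i, -, hi⟩ := Finset.mem_biUnion.1 (t.min'_mem hne)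
  obtain ⟨κ, hκ, hκν⟩ := Finset.mem_image.1 hi
  refine ⟨t.min' hne, hκν ▸ κ.2, ?_, ?_⟩
  · rw [← hκν]
    exact hasEigenvalue_of_hasEigenvector ⟨hf i κ, Finsupp.mem_support_iff.1 hκ⟩
  · have hmem : ∀ i, (v i : H) ∈ (⨆ κ : Set.Ici (t.min' hne),
        eigenspace (S : H →ₗ[ℂ] H) ((κ : ℝ) : ℂ) : Submodule ℂ H) := fun i => by
      rw [← hsum i]
      refine Submodule.sum_mem _ fun κ hκ => ?_
      exact Submodule.mem_iSup_of_mem (p := fun κ : Set.Ici (t.min' hne) =>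
        eigenspace (S : H →ₗ[ℂ] H) ((κ : ℝ) : ℂ)) ⟨κ, t.min'_le _ (ht_mem i κ hκ)⟩ (hf i κ)
    refine Module.le_rank_iff.2 ⟨fun i => ⟨v i, hmem i⟩, ?_⟩
    refine LinearIndependent.of_comp (Submodule.subtype _) ?_
    exact hv.map' W.subtype (Submodule.ker_subtype W)

/-- The Courant–Fischer lower bound: if the quadratic form of a compact self-adjoint operator is at
least `μ` on the unit sphere of an `n`-dimensional space, `n > 0`, the `n`-th eigenvalue is at
least `μ`. -/
theorem le_nthEigenvalue [CompleteSpace H] {S : H →L[ℂ] H} (hc : IsCompactOperator S)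
    (hS : (S : H →ₗ[ℂ] H).IsSymmetric) {n : ℕ} (hn : 0 < n) (V : Submodule ℂ H)
    (hV : Module.finrank ℂ V = n) {μ : ℝ}
    (h : ∀ f ∈ V, μ * ‖f‖ ^ 2 ≤ (inner ℂ (S f) f).re) : μ ≤ nthEigenvalue S n := by
  have : FiniteDimensional ℂ V := Module.finite_of_finrank_pos (hV ▸ hn)
  -- The upper bound on the form away from large eigenvalues is not strict, so an intermediate `κ'`
  -- provides the slack.
  refine le_of_forall_lt fun κ hκ => ?_
  obtain ⟨κ', hκ', hκμ⟩ := exists_between hκ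
  set W := (⨆ ν : Set.Ici κ', eigenspace (S : H →ₗ[ℂ] H) ((ν : ℝ) : ℂ) : Submodule ℂ H)
  have hrank : (n : Cardinal) ≤ Module.rank ℂ W := by
    by_contra! hlt
    have hfin : FiniteDimensional ℂ W :=
      Module.rank_lt_aleph0_iff.1 (hlt.trans (Cardinal.natCast_lt_aleph0))
    have hlt' : Module.finrank ℂ W < Module.finrank ℂ V := by
      rw [← Module.finrank_eq_rank] at hlt
      rw [hV]
      exact_mod_cast hlt
    obtain ⟨f, hf, hf0⟩ := (Submodule.ne_bot_iff _).1 (LinearMap.ker_ne_bot_of_finrank_lt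
      (f := (W.orthogonalProjectionOnto : H →ₗ[ℂ] W) ∘ₗ V.subtype) hlt')
    have hfW : (f : H) ∈ Wᗮ := Submodule.orthogonalProjectionOnto_eq_zero_iff.1 hf
    have h1 := (h f f.2).trans (re_inner_le_of_mem_orthogonal hc hS hfW)
    have h2 : 0 < ‖(f : H)‖ ^ 2 := by
      have : (f : H) ≠ 0 := fun h => hf0 (Subtype.ext h)
      positivity
    exact absurd (le_of_mul_le_mul_right h1 h2) (not_le.2 hκμ)
  obtain ⟨ν, hκν, hν, hνr⟩ := exists_hasEigenvalue_rank_le hn hrank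
  refine (hκ'.trans_le hκν).trans_le (le_csSup ⟨‖S‖, ?_⟩ ⟨hν, hνr⟩)
  rintro ν ⟨hν, -⟩
  obtain ⟨x, hx, hx0⟩ := hν.exists_hasEigenvector
  have h1 := S.le_opNorm x
  have h2 : S x = (ν : ℂ) • x := mem_eigenspace_iff.1 hx
  rw [h2, norm_smul, Complex.norm_real] at h1
  exact (le_abs_self ν).trans (le_of_mul_le_mul_right h1 (norm_pos_iff.2 hx0))

end MinMax

/-! ### The Fourier transform on `L¹ ∩ L²` and compactness -/

section FourierCompact

open scoped FourierTransform SchwartzMap ContDiff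
open Complex

theorem timeProj_coeFn {T : Set ℝ} (hT : MeasurableSet T) (f : L2R) :
    (timeProj hT f : ℝ → ℂ) =ᵐ[volume] T.indicator (f : ℝ → ℂ) :=
  truncate_coeFn hT f

/-- Both sides have the same integral against test functions, since both Fourier transforms can be
moved onto the test function. -/
theorem fourierL2_coeFn {f : L2R} (hf : Integrable (f : ℝ → ℂ)) :
    (fourierL2 f : ℝ → ℂ) =ᵐ[volume] 𝓕 (f : ℝ → ℂ) := by
  have hcont : Continuous (𝓕 (f : ℝ → ℂ)) :=
    VectorFourier.fourierIntegral_continuous Real.continuous_fourierChar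
      (by exact continuous_inner) hf
  refine ae_eq_of_integral_contDiff_smul_eq
    ((Lp.memLp _).locallyIntegrable (by norm_num)) hcont.locallyIntegrable ?_
  intro g hg hgc
  have hgc' : HasCompactSupport (fun x => (g x : ℂ)) :=
    hgc.comp_left (g := ((↑) : ℝ → ℂ)) Complex.ofReal_zero
  let φ : 𝓢(ℝ, ℂ) := hgc'.toSchwartzMap (Complex.ofRealCLM.contDiff.comp hg)
  have hφ : ∀ x, φ x = (g x : ℂ) := fun x => rfl
  have h1 := DFunLike.congr_fun (Lp.fourier_toTemperedDistribution_eq f) φ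
  rw [TemperedDistribution.fourier_apply, Lp.toTemperedDistribution_apply,
    Lp.toTemperedDistribution_apply] at h1
  have h2 : ∫ x, (𝓕 φ) x • (f : ℝ → ℂ) x = ∫ x, φ x • 𝓕 (f : ℝ → ℂ) x := by
    rw [SchwartzMap.fourier_coe]
    simpa using! (VectorFourier.integral_fourierIntegral_smul_eq_flip (L := innerₗ ℝ)
      Real.continuous_fourierChar continuous_inner φ.integrable hf)
  rw [h2] at h1
  simp only [hφ, smul_eq_mul] at h1
  simp only [Complex.real_smul]
  exact h1.symm

theorem integrable_timeProj_and_integral_norm_le {T : Set ℝ} (hT : MeasurableSet T) (hTf : volume T ≠ ⊤) (f : L2R) :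
    Integrable (timeProj hT f : ℝ → ℂ) ∧
      ∫ x, ‖(timeProj hT f : ℝ → ℂ) x‖ ≤ (volume T).toReal ^ (1 / 2 : ℝ) * ‖f‖ := by
  have hae := timeProj_coeFn hT f
  have h1 : eLpNorm (timeProj hT f : ℝ → ℂ) 1 volume ≤
      eLpNorm (f : ℝ → ℂ) 2 volume * (volume T) ^ (1 / 2 : ℝ) := by
    rw [eLpNorm_congr_ae hae, eLpNorm_indicator_eq_eLpNorm_restrict hT]
    refine (eLpNorm_le_eLpNorm_mul_rpow_measure_univ (p := 1) (q := 2) (by norm_num)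
      (Lp.aestronglyMeasurable f).restrict).trans ?_
    rw [Measure.restrict_apply_univ]
    rw [show 1 / (1 : ENNReal).toReal - 1 / (2 : ENNReal).toReal = (1 / 2 : ℝ) by norm_num]
    exact mul_le_mul_left (eLpNorm_mono_measure _ Measure.restrict_le_self) _
  have hfin : eLpNorm (f : ℝ → ℂ) 2 volume * (volume T) ^ (1 / 2 : ℝ) ≠ ⊤ :=
    ENNReal.mul_ne_top (Lp.eLpNorm_ne_top f) (ENNReal.rpow_ne_top_of_nonneg (by norm_num) hTf)
  have hint : MemLp (timeProj hT f : ℝ → ℂ) 1 volume :=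
    ⟨Lp.aestronglyMeasurable _, h1.trans_lt hfin.lt_top⟩
  refine ⟨memLp_one_iff_integrable.1 hint, ?_⟩
  rw [integral_norm_eq_lintegral_enorm (Lp.aestronglyMeasurable _), ← eLpNorm_one_eq_lintegral_enorm]
  refine (ENNReal.toReal_mono hfin h1).trans_eq ?_
  rw [ENNReal.toReal_mul, ← ENNReal.toReal_rpow, mul_comm]
  rfl

/-- The norm of an `L²` function carried by a set of finite measure and bounded there. -/
theorem norm_le_of_ae_le_indicator {Ω : Set ℝ} (hΩ : MeasurableSet Ω) (hΩf : volume Ω ≠ ⊤)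
    {h : L2R} {B : ℝ} (hB : 0 ≤ B)
    (hh : ∀ᵐ x, ‖(h : ℝ → ℂ) x‖ ≤ Ω.indicator (fun _ => B) x) :
    ‖h‖ ≤ B * (volume Ω).toReal ^ (1 / 2 : ℝ) := by
  have h1 : ‖h‖ ≤ ‖indicatorConstLp 2 hΩ hΩf (B : ℂ)‖ := by
    refine Lp.norm_le_norm_of_ae_le ?_
    filter_upwards [hh, indicatorConstLp_coeFn (p := 2) (hs := hΩ) (hμs := hΩf) (c := (B : ℂ))]
      with x h1 h2
    rw [h2]
    refine h1.trans_eq ?_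
    by_cases hx : x ∈ Ω <;> simp [hx, abs_of_nonneg hB]
  refine h1.trans_eq ?_
  rw [norm_indicatorConstLp (by norm_num) (by norm_num), Complex.norm_real,
    Real.norm_of_nonneg hB]
  norm_num
  exact Or.inl rfl

/-- On bounded sets the kernel `exp (-2πi x ξ)` is the uniform limit of its Taylor polynomials in
`x ξ`, which are kernels of operators of finite rank. -/
theorem isCompactOperator_timeProj_fourierL2_timeProj {T Ω : Set ℝ} (hT : MeasurableSet T)
    (hΩ : MeasurableSet Ω) (hTb : Bornology.IsBounded T) (hΩb : Bornology.IsBounded Ω) :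
    IsCompactOperator (timeProj hΩ ∘L fourierL2 ∘L timeProj hT) := by
  have hTf : volume T ≠ ⊤ := hTb.measure_lt_top.ne
  have hΩf : volume Ω ≠ ⊤ := hΩb.measure_lt_top.ne
  obtain ⟨R, hR0, hR⟩ := hTb.exists_pos_norm_le
  obtain ⟨R', hR0', hR'⟩ := hΩb.exists_pos_norm_le
  have hmem : ∀ {E : Set ℝ} (hE : MeasurableSet E) (hEb : Bornology.IsBounded E) (k : ℕ) (a : ℂ),
      MemLp (E.indicator fun x : ℝ => a * (x : ℂ) ^ k) 2 volume := by
    intro E hE hEb k a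
    obtain ⟨r, hr⟩ := hEb.exists_norm_le
    rw [memLp_indicator_iff_restrict hE]
    have : IsFiniteMeasure (volume.restrict E) := ⟨by simpa using hEb.measure_lt_top⟩
    refine MemLp.of_bound (by fun_prop) (‖a‖ * r ^ k) ?_
    filter_upwards [ae_restrict_mem hE] with x hx
    rw [norm_mul, norm_pow, Complex.norm_real]
    gcongr
    exact hr x hx
  let v : ℕ → L2R := fun k => (hmem hT hTb k 1).toLp
  let u : ℕ → L2R := fun k => (hmem hΩ hΩb k ((-2 * Real.pi * I) ^ k / k.factorial)).toLp
  let A : ℕ → (L2R →L[ℂ] L2R) := fun N =>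
    ∑ k ∈ Finset.range N, (ContinuousLinearMap.toSpanSingleton ℂ (u k)) ∘L (innerSL ℂ (v k))
  have hA : ∀ N, IsCompactOperator (A N) := by
    intro N
    have : A N ∈ compactOperator (RingHom.id ℂ) L2R L2R := by
      refine Submodule.sum_mem _ fun k _ => ?_
      exact (isCompactOperator_of_locallyCompactSpace_dom (innerSL ℂ (v k))).clm_comp
        (ContinuousLinearMap.toSpanSingleton ℂ (u k))
    exact this
  set M : ℝ := 2 * Real.pi * (R * R') with hM
  set C : ℝ := (volume T).toReal ^ (1 / 2 : ℝ) * (volume Ω).toReal ^ (1 / 2 : ℝ) with hC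
  have hinner : ∀ (k : ℕ) (f : L2R),
      Integrable (fun y : ℝ => (y : ℂ) ^ k * (timeProj hT f : ℝ → ℂ) y) ∧
      inner ℂ (v k) f = ∫ y : ℝ, (y : ℂ) ^ k * (timeProj hT f : ℝ → ℂ) y := by
    intro k f
    have hae : (fun y => inner ℂ ((v k : ℝ → ℂ) y) ((f : ℝ → ℂ) y)) =ᵐ[volume]
        fun y : ℝ => (y : ℂ) ^ k * (timeProj hT f : ℝ → ℂ) y := by
      filter_upwards [(hmem hT hTb k 1).coeFn_toLp, timeProj_coeFn hT f] with y h1 h2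
      rw [h1, h2]
      by_cases hy : y ∈ T <;> simp [hy, mul_comm]
    exact ⟨(L2.integrable_inner (v k) f).congr hae, by
      rw [L2.inner_def, integral_congr_ae hae]⟩
  have hbound : ∀ N : ℕ, M / (N + 1 : ℕ) ≤ 1 / 2 →
      ‖(timeProj hΩ ∘L fourierL2 ∘L timeProj hT) - A N‖ ≤ M ^ N / N.factorial * 2 * C := by
    intro N hN
    have hη : 0 ≤ M ^ N / N.factorial * 2 := by
      have : 0 ≤ M := by positivity
      positivity
    refine ContinuousLinearMap.opNorm_le_bound _ (by positivity) fun f => ?_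
    obtain ⟨hint, hintle⟩ := integrable_timeProj_and_integral_norm_le hT hTf f
    refine (norm_le_of_ae_le_indicator hΩ hΩf
      (B := M ^ N / N.factorial * 2 * ((volume T).toReal ^ (1 / 2 : ℝ) * ‖f‖)) (by positivity)
      ?_).trans_eq (by rw [hC]; ring)
    have hAf : A N f = ∑ k ∈ Finset.range N, (inner ℂ (v k) f : ℂ) • u k := by
      simp [A]
    have hAe : (A N f : ℝ → ℂ) =ᵐ[volume] Ω.indicator fun ξ : ℝ => ∑ k ∈ Finset.range N,
        (inner ℂ (v k) f : ℂ) * ((-2 * Real.pi * I) ^ k / k.factorial * (ξ : ℂ) ^ k) := by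
      rw [hAf]
      have h2 : ∀ᵐ ξ : ℝ, ∀ k ∈ Finset.range N, (((inner ℂ (v k) f : ℂ) • u k : L2R) : ℝ → ℂ) ξ =
          (inner ℂ (v k) f : ℂ) * Ω.indicator
            (fun ξ : ℝ => (-2 * Real.pi * I) ^ k / k.factorial * (ξ : ℂ) ^ k) ξ := by
        rw [Filter.eventually_all_finset]
        intro k _
        filter_upwards [Lp.coeFn_smul (inner ℂ (v k) f : ℂ) (u k),
          (hmem hΩ hΩb k ((-2 * Real.pi * I) ^ k / k.factorial)).coeFn_toLp] with ξ h3 h4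
        rw [h3, Pi.smul_apply, h4, smul_eq_mul]
      filter_upwards [Lp.coeFn_finsetSum (Finset.range N) fun k => (inner ℂ (v k) f : ℂ) • u k, h2]
        with ξ h3 h4
      rw [h3, Finset.sum_apply, Finset.sum_congr rfl h4]
      by_cases hξ : ξ ∈ Ω <;> simp [hξ]
    filter_upwards [hAe, timeProj_coeFn hΩ (fourierL2 (timeProj hT f)), fourierL2_coeFn hint,
      Lp.coeFn_sub ((timeProj hΩ ∘L fourierL2 ∘L timeProj hT) f) (A N f)] with ξ h1 h2 h3 h4
    rw [sub_apply, h4, Pi.sub_apply, h1]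
    have h5 : ((timeProj hΩ ∘L fourierL2 ∘L timeProj hT) f : ℝ → ℂ) ξ =
      Ω.indicator (fourierL2 (timeProj hT f) : ℝ → ℂ) ξ := h2
    rw [h5]
    by_cases hξ : ξ ∈ Ω
    swap
    · simp [hξ]
    rw [Set.indicator_of_mem hξ, Set.indicator_of_mem hξ, Set.indicator_of_mem hξ, h3,
      Real.fourier_real_eq_integral_exp_smul]
    have hterm : ∀ k ∈ Finset.range N, Integrable fun y : ℝ =>
        ((↑(-2 * Real.pi * y * ξ) * I) ^ k / k.factorial : ℂ) •
          (timeProj hT f : ℝ → ℂ) y := by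
      intro k _
      refine ((hinner k f).1.mul_const
        ((-2 * Real.pi * I) ^ k / k.factorial * (ξ : ℂ) ^ k)).congr
        (Filter.Eventually.of_forall fun y => ?_)
      simp only [smul_eq_mul]
      push_cast
      ring
    have hsum : ∑ k ∈ Finset.range N,
        (inner ℂ (v k) f : ℂ) * ((-2 * Real.pi * I) ^ k / k.factorial * (ξ : ℂ) ^ k) =
        ∫ y : ℝ, (∑ k ∈ Finset.range N, (↑(-2 * Real.pi * y * ξ) * I) ^ k / k.factorial) •
          (timeProj hT f : ℝ → ℂ) y := by
      simp only [Finset.sum_smul]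
      rw [integral_finsetSum]
      · refine Finset.sum_congr rfl fun k _ => ?_
        rw [(hinner k f).2, ← integral_mul_const]
        refine integral_congr_ae (Filter.Eventually.of_forall fun y => ?_)
        simp only [smul_eq_mul]
        push_cast
        ring
      · exact hterm
    have hexp : Integrable fun y : ℝ =>
        exp (↑(-2 * Real.pi * y * ξ) * I) • (timeProj hT f : ℝ → ℂ) y := by
      refine hint.bdd_mul (c := 1) (by fun_prop) (Filter.Eventually.of_forall fun y => ?_)
      rw [Complex.norm_exp_ofReal_mul_I]
    have hpoly : Integrable fun y : ℝ =>
        (∑ k ∈ Finset.range N, (↑(-2 * Real.pi * y * ξ) * I) ^ k / k.factorial) •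
          (timeProj hT f : ℝ → ℂ) y := by
      simp only [Finset.sum_smul]
      exact integrable_finsetSum _ hterm
    rw [hsum, ← integral_sub hexp hpoly]
    calc _ ≤ ∫ y, M ^ N / N.factorial * 2 * ‖(timeProj hT f : ℝ → ℂ) y‖ := by
          refine norm_integral_le_of_norm_le (hint.norm.const_mul _) ?_
          filter_upwards [timeProj_coeFn hT f] with y hy
          by_cases hyT : y ∈ T
          swap
          · simp [hy, hyT]
          rw [← sub_smul, norm_smul]
          refine mul_le_mul_of_nonneg_right ?_ (norm_nonneg _)
          have hz : ‖(↑(-2 * Real.pi * y * ξ) * I : ℂ)‖ ≤ M := by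
            rw [norm_mul, Complex.norm_I, mul_one, Complex.norm_real, norm_mul, norm_mul, norm_mul,
              norm_neg, Real.norm_of_nonneg Real.pi_pos.le, Real.norm_ofNat, hM, ← mul_assoc]
            have := hR y hyT
            have := hR' ξ hξ
            gcongr
          refine (Complex.exp_bound' ((div_le_div_of_nonneg_right hz (by positivity)).trans hN)).trans
            ?_
          gcongr
      _ ≤ _ := by
          rw [integral_const_mul]
          exact mul_le_mul_of_nonneg_left hintle hη
  have hlim : Filter.Tendsto (fun N : ℕ => M ^ N / N.factorial * 2 * C) Filter.atTop (nhds 0) := by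
    simpa using ((FloorSemiring.tendsto_pow_div_factorial_atTop M).mul_const 2).mul_const C
  have hev : ∀ᶠ N : ℕ in Filter.atTop, M / (N + 1 : ℕ) ≤ 1 / 2 := by
    have : Filter.Tendsto (fun N : ℕ => M / (N + 1 : ℕ)) Filter.atTop (nhds 0) :=
      (tendsto_const_div_atTop_nhds_zero_nat M).comp (Filter.tendsto_add_atTop_nat 1)
    exact this.eventually_le_const (by norm_num)
  refine isCompactOperator_of_tendsto (l := Filter.atTop) (F := A) ?_ (Filter.Eventually.of_forall hA)
  rw [tendsto_iff_norm_sub_tendsto_zero]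
  refine squeeze_zero' (Filter.Eventually.of_forall fun _ => norm_nonneg _) ?_ hlim
  filter_upwards [hev] with N hN
  rw [norm_sub_rev]
  exact hbound N hN

theorem isCompactOperator_timeFreqOp {T Ω : Set ℝ} (hT : MeasurableSet T)
    (hΩ : MeasurableSet Ω) (hTb : Bornology.IsBounded T) (hΩb : Bornology.IsBounded Ω) :
    IsCompactOperator (timeFreqOp hT hΩ) :=
  (isCompactOperator_timeProj_fourierL2_timeProj hT hΩ hTb hΩb).clm_comp
    (timeProj hT ∘L fourierInvL2)

theorem inner_timeProj_left {T : Set ℝ} (hT : MeasurableSet T) (f g : L2R) :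
    inner ℂ (timeProj hT f) g = inner ℂ f (timeProj hT g) := by
  rw [L2.inner_def, L2.inner_def]
  refine integral_congr_ae ?_
  filter_upwards [timeProj_coeFn hT f, timeProj_coeFn hT g] with x h1 h2
  rw [h1, h2]
  by_cases hx : x ∈ T <;> simp [hx]

theorem timeProj_timeProj {T : Set ℝ} (hT : MeasurableSet T) (f : L2R) :
    timeProj hT (timeProj hT f) = timeProj hT f := by
  refine Lp.ext ?_
  filter_upwards [timeProj_coeFn hT f, timeProj_coeFn hT (timeProj hT f)] with x h1 h2
  rw [h2]
  by_cases hx : x ∈ T <;> simp [hx, h1]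

theorem inner_fourierInvL2_left (f g : L2R) :
    inner ℂ (fourierInvL2 f) g = inner ℂ f (fourierL2 g) := by
  rw [← (Lp.fourierTransformₗᵢ ℝ ℂ).inner_map_map]
  congr 1
  exact (Lp.fourierTransformₗᵢ ℝ ℂ).apply_symm_apply f

/-- `⟪P_T Q_Ω P_T f, g⟫ = ⟪P_Ω 𝓕 P_T f, P_Ω 𝓕 P_T g⟫`. -/
theorem inner_timeFreqOp {T Ω : Set ℝ} (hT : MeasurableSet T) (hΩ : MeasurableSet Ω) (f g : L2R) :
    inner ℂ (timeFreqOp hT hΩ f) g =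
      inner ℂ (timeProj hΩ (fourierL2 (timeProj hT f)))
        (timeProj hΩ (fourierL2 (timeProj hT g))) := by
  calc inner ℂ (timeFreqOp hT hΩ f) g
      = inner ℂ (fourierInvL2 (timeProj hΩ (fourierL2 (timeProj hT f)))) (timeProj hT g) :=
        inner_timeProj_left hT _ _
    _ = inner ℂ (timeProj hΩ (fourierL2 (timeProj hT f))) (fourierL2 (timeProj hT g)) :=
        inner_fourierInvL2_left _ _
    _ = _ := by rw [← inner_timeProj_left, timeProj_timeProj]

theorem isSymmetric_timeFreqOp {T Ω : Set ℝ} (hT : MeasurableSet T) (hΩ : MeasurableSet Ω) :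
    (timeFreqOp hT hΩ : L2R →ₗ[ℂ] L2R).IsSymmetric := by
  intro f g
  have h1 := inner_timeFreqOp hT hΩ f g
  have h2 := congrArg (starRingEnd ℂ) (inner_timeFreqOp hT hΩ g f)
  rw [inner_conj_symm, inner_conj_symm] at h2
  exact h1.trans h2.symm

end FourierCompact

/-! ### Compactly supported windows with small Fourier tails -/

section Window

open scoped FourierTransform ContDiff
open Real (pi)

theorem norm_fourier_comp_add_right (g : ℝ → ℂ) (h ξ : ℝ) :
    ‖𝓕 (fun x => g (x + h)) ξ‖ = ‖𝓕 g ξ‖ := by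
  have := congrFun (VectorFourier.fourierIntegral_comp_add_right (μ := volume) Real.fourierChar
    (innerₗ ℝ) g h) ξ
  exact (congrArg norm this).trans (Circle.norm_smul _ _)

theorem fourier_fourierChar_smul (g : ℝ → ℂ) (ν ξ : ℝ) :
    𝓕 (fun x => (Real.fourierChar (ν * x) : Circle) • g x) ξ = 𝓕 g (ξ - ν) := by
  rw [Real.fourier_real_eq, Real.fourier_real_eq]
  refine integral_congr_ae (Filter.Eventually.of_forall fun x => ?_)
  simp only [smul_smul, ← AddChar.map_add_eq_mul]
  congr 2
  ring

theorem hasCompactSupport_of_eq_zero {g : ℝ → ℂ} {x₀ R : ℝ} (h0 : ∀ x, R < |x - x₀| → g x = 0) :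
    HasCompactSupport g :=
  HasCompactSupport.intro (isCompact_closedBall x₀ R) fun x hx => h0 x (by
    simpa [Real.dist_eq] using hx)

/-- Averaging over a window of width `w`: the plateau shrinks and the support grows by `w / 2`,
while the Fourier transform gains a factor `1 / (π w |ξ|)` because the derivative of the average is
the difference quotient `(g (x + w / 2) - g (x - w / 2)) / w`. -/
theorem exists_average {g : ℝ → ℂ} (hg : Continuous g) {x₀ r R w : ℝ} (hw : 0 < w)
    (h1 : ∀ x, |x - x₀| ≤ r → g x = 1) (h0 : ∀ x, R < |x - x₀| → g x = 0) :
    ∃ g₁ : ℝ → ℂ, Continuous g₁ ∧ (∀ x, |x - x₀| ≤ r - w / 2 → g₁ x = 1) ∧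
      (∀ x, R + w / 2 < |x - x₀| → g₁ x = 0) ∧
      ∀ ξ, pi * w * |ξ| * ‖𝓕 g₁ ξ‖ ≤ ‖𝓕 g ξ‖ := by
  have hgi : Integrable g := hg.integrable_of_hasCompactSupport (hasCompactSupport_of_eq_zero h0)
  set g₁ : ℝ → ℂ := fun x => (w : ℂ)⁻¹ * ∫ t in (x - w / 2)..(x + w / 2), g t with hg₁
  have hderiv : ∀ x, HasDerivAt g₁ ((w : ℂ)⁻¹ * (g (x + w / 2) - g (x - w / 2))) x := by
    intro x
    have hG : ∀ y, HasDerivAt (fun y => ∫ t in (0 : ℝ)..y, g t) (g y) y := fun y =>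
      intervalIntegral.integral_hasDerivAt_right (hg.intervalIntegrable _ _)
        hg.stronglyMeasurable.stronglyMeasurableAtFilter hg.continuousAt
    have := (((hG (x + w / 2)).comp_add_const x (w / 2)).sub
      ((hG (x - w / 2)).comp_sub_const x (w / 2))).const_mul (w : ℂ)⁻¹
    refine this.congr_of_eventuallyEq (Filter.Eventually.of_forall fun y => ?_)
    simp only [hg₁, Pi.sub_apply]
    rw [intervalIntegral.integral_interval_sub_left (hg.intervalIntegrable _ _)
      (hg.intervalIntegrable _ _)]
  have hcont : Continuous g₁ := continuous_iff_continuousAt.2 fun x => (hderiv x).continuousAt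
  have hzero : ∀ x, R + w / 2 < |x - x₀| → g₁ x = 0 := by
    intro x hx
    simp only [hg₁]
    rw [intervalIntegral.integral_zero_ae, mul_zero]
    refine Filter.Eventually.of_forall fun t ht => h0 t ?_
    rw [Set.uIoc_of_le (by linarith)] at ht
    have h2 : |x - t| ≤ w / 2 := abs_le.2 ⟨by linarith [ht.2], by linarith [ht.1]⟩
    have := abs_sub_le x t x₀
    linarith
  refine ⟨g₁, hcont, ?_, hzero, fun ξ => ?_⟩
  · intro x hx
    have : ∫ t in (x - w / 2)..(x + w / 2), g t = ∫ t in (x - w / 2)..(x + w / 2), (1 : ℂ) := by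
      refine intervalIntegral.integral_congr fun t ht => h1 t ?_
      rw [Set.uIcc_of_le (by linarith)] at ht
      have h2 : |t - x| ≤ w / 2 := abs_le.2 ⟨by linarith [ht.1], by linarith [ht.2]⟩
      have := abs_sub_le t x x₀
      linarith
    simp only [hg₁, this, intervalIntegral.integral_const]
    rw [show x + w / 2 - (x - w / 2) = w by ring, Complex.real_smul, mul_one,
      inv_mul_cancel₀ (by exact_mod_cast hw.ne')]
  · have hi1 : Integrable fun x => g (x + w / 2) := hgi.comp_add_right _
    have hi2 : Integrable fun x => g (x + -(w / 2)) := hgi.comp_add_right _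
    have hd : deriv g₁ = (w : ℂ)⁻¹ • ((fun x => g (x + w / 2)) - fun x => g (x + -(w / 2))) := by
      ext x
      rw [(hderiv x).deriv]
      simp [sub_eq_add_neg]
    have hF := congrFun (Real.fourier_deriv (hcont.integrable_of_hasCompactSupport
      (hasCompactSupport_of_eq_zero hzero)) (fun x => (hderiv x).differentiableAt)
      (by rw [hd]; exact (hi1.sub hi2).smul _)) ξ
    have hF' : 𝓕 (deriv g₁) ξ = (w : ℂ)⁻¹ •
        (𝓕 (fun x => g (x + w / 2)) ξ - 𝓕 (fun x => g (x + -(w / 2))) ξ) := by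
      rw [hd, Real.fourier_eq, Real.fourier_eq, Real.fourier_eq, ← integral_sub, ← integral_smul]
      · refine integral_congr_ae (Filter.Eventually.of_forall fun x => ?_)
        simp only [Pi.smul_apply, Pi.sub_apply, Circle.smul_def, smul_eq_mul]
        ring
      · exact (Real.fourierIntegral_convergent_iff ξ).2 hi1
      · exact (Real.fourierIntegral_convergent_iff ξ).2 hi2
    rw [hF'] at hF
    have hn := congrArg norm hF
    have hle : ‖(w : ℂ)⁻¹ • (𝓕 (fun x => g (x + w / 2)) ξ - 𝓕 (fun x => g (x + -(w / 2))) ξ)‖ ≤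
        w⁻¹ * (2 * ‖𝓕 g ξ‖) := by
      rw [norm_smul, norm_inv, Complex.norm_real, Real.norm_of_nonneg hw.le]
      refine mul_le_mul_of_nonneg_left ((norm_sub_le _ _).trans_eq ?_) (inv_nonneg.2 hw.le)
      rw [norm_fourier_comp_add_right, norm_fourier_comp_add_right, two_mul]
    rw [hn, norm_smul] at hle
    have h2 : ‖(2 * pi * Complex.I * ξ : ℂ)‖ = 2 * pi * |ξ| := by
      simp [abs_of_pos Real.pi_pos]
    rw [h2, inv_mul_eq_div, le_div_iff₀ hw] at hle
    nlinarith

/-- Iterated averages of a bump function `g₀`. The plateau statement is vacuous when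
`r < m * (w / 2)`. -/
theorem exists_window (x₀ : ℝ) {r R w : ℝ} (hr : 0 < r) (hrR : r < R) (hw : 0 < w) (m : ℕ) :
    ∃ g g₀ : ℝ → ℂ, Continuous g ∧ (∀ x, |x - x₀| ≤ r - m * (w / 2) → g x = 1) ∧
      (∀ x, R + m * (w / 2) < |x - x₀| → g x = 0) ∧ Continuous g₀ ∧ (∀ x, ‖g₀ x‖ ≤ 1) ∧
      (∀ x, R < |x - x₀| → g₀ x = 0) ∧ ∀ ξ, (pi * w * |ξ|) ^ m * ‖𝓕 g ξ‖ ≤ ‖𝓕 g₀ ξ‖ := by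
  induction m with
  | zero =>
    let b : ContDiffBump x₀ := ⟨r, R, hr, hrR⟩
    have hb0 : ∀ x, R < |x - x₀| → (b x : ℂ) = 0 := fun x hx => by
      rw [b.zero_of_le_dist (by rw [Real.dist_eq]; exact hx.le), Complex.ofReal_zero]
    have hbc : Continuous fun x => (b x : ℂ) := Complex.continuous_ofReal.comp b.continuous
    refine ⟨fun x => b x, fun x => b x, hbc, fun x hx => ?_, fun x hx => hb0 x (by simpa using hx),
      hbc, fun x => ?_, hb0, fun ξ => by simp⟩
    · change (b x : ℂ) = 1
      rw [b.one_of_mem_closedBall (by simpa [Real.dist_eq] using hx), Complex.ofReal_one]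
    · rw [Complex.norm_real, Real.norm_of_nonneg b.nonneg]
      exact b.le_one
  | succ m ih =>
    obtain ⟨g, g₀, hg, h1, h0, hg₀, hb, h0', hF⟩ := ih
    obtain ⟨g', hg', h1', h0'', hF'⟩ := exists_average hg hw h1 h0
    refine ⟨g', g₀, hg', fun x hx => h1' x (hx.trans_eq ?_),
      fun x hx => h0'' x (hx.trans_eq' ?_), hg₀, hb, h0', fun ξ => ?_⟩
    · push_cast; ring
    · push_cast; ring
    · refine le_trans ?_ (hF ξ)
      rw [pow_succ, mul_assoc]
      exact mul_le_mul_of_nonneg_left (hF' ξ) (by have := Real.pi_pos; positivity)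

end Window

/-! ### Modulated windows as trial functions -/

section TrialFunctions

open scoped FourierTransform
open Real (pi)

theorem norm_fourierL2 (f : L2R) : ‖fourierL2 f‖ = ‖f‖ :=
  (Lp.fourierTransformₗᵢ ℝ ℂ).norm_map f

theorem norm_sq_eq_norm_timeProj_sq_add {Ω : Set ℝ} (hΩ : MeasurableSet Ω) (f : L2R) :
    ‖f‖ ^ 2 = ‖timeProj hΩ f‖ ^ 2 + ‖f - timeProj hΩ f‖ ^ 2 := by
  have h : inner ℂ (timeProj hΩ f) (f - timeProj hΩ f) = 0 := by
    rw [inner_timeProj_left, map_sub, timeProj_timeProj, sub_self, inner_zero_right]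
  have := norm_add_sq_eq_norm_sq_add_norm_sq_of_inner_eq_zero _ _ h
  rw [add_sub_cancel] at this
  nlinarith

/-- Trial vectors supported in `T`, with Riesz lower bound `L` and Fourier transforms carried by
`Ω` up to an error `η`, bound the `n`-th eigenvalue from below. -/
theorem le_nthEigenvalue_timeFreqOp {T Ω : Set ℝ} (hT : MeasurableSet T) (hΩ : MeasurableSet Ω)
    (hTb : Bornology.IsBounded T) (hΩb : Bornology.IsBounded Ω) {n : ℕ} (hn : 0 < n)
    (φ : Fin n → L2R) {η L : ℝ} (hL : 0 < L) (hφT : ∀ k, timeProj hT (φ k) = φ k)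
    (hφΩ : ∀ k, ‖fourierL2 (φ k) - timeProj hΩ (fourierL2 (φ k))‖ ≤ η)
    (hφ : ∀ a : Fin n → ℂ, L * ∑ k, ‖a k‖ ^ 2 ≤ ‖∑ k, a k • φ k‖ ^ 2) :
    1 - η ^ 2 * n / L ≤ nthEigenvalue (timeFreqOp hT hΩ) n := by
  have hli : LinearIndependent ℂ φ := by
    rw [Fintype.linearIndependent_iff]
    intro a ha k
    have h1 := hφ a
    rw [ha, norm_zero, zero_pow two_ne_zero] at h1
    have h2 : ∑ k, ‖a k‖ ^ 2 ≤ 0 := by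
      by_contra! h
      exact absurd h1 (not_le.2 (mul_pos hL h))
    have h3 := (Finset.sum_eq_zero_iff_of_nonneg fun k _ => sq_nonneg ‖a k‖).1
      (h2.antisymm (Finset.sum_nonneg fun k _ => sq_nonneg _)) k (Finset.mem_univ k)
    simpa using h3
  refine le_nthEigenvalue (isCompactOperator_timeFreqOp hT hΩ hTb hΩb)
    (isSymmetric_timeFreqOp hT hΩ) hn (Submodule.span ℂ (Set.range φ))
    (by rw [finrank_span_eq_card hli, Fintype.card_fin]) fun f hf => ?_
  obtain ⟨a, rfl⟩ := (Submodule.mem_span_range_iff_exists_fun ℂ).1 hf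
  set f := ∑ k, a k • φ k with hfdef
  have hfT : timeProj hT f = f := by simp [hfdef, hφT]
  have htail : ‖fourierL2 f - timeProj hΩ (fourierL2 f)‖ ≤ (∑ k, ‖a k‖) * η := by
    have : fourierL2 f - timeProj hΩ (fourierL2 f) =
        ∑ k, a k • (fourierL2 (φ k) - timeProj hΩ (fourierL2 (φ k))) := by
      simp [hfdef, smul_sub]
    rw [this, Finset.sum_mul]
    refine norm_sum_le_of_le _ fun k _ => ?_
    rw [norm_smul]
    exact mul_le_mul_of_nonneg_left (hφΩ k) (norm_nonneg _)
  have hcs : (∑ k, ‖a k‖) ^ 2 ≤ n * ∑ k, ‖a k‖ ^ 2 := by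
    simpa using sq_sum_le_card_mul_sum_sq (s := Finset.univ) (f := fun k => ‖a k‖)
  have htail2 : ‖fourierL2 f - timeProj hΩ (fourierL2 f)‖ ^ 2 ≤ η ^ 2 * n / L * ‖f‖ ^ 2 := by
    calc _ ≤ ((∑ k, ‖a k‖) * η) ^ 2 := pow_le_pow_left₀ (norm_nonneg _) htail 2
      _ = η ^ 2 * (∑ k, ‖a k‖) ^ 2 := by ring
      _ ≤ η ^ 2 * (n * (‖f‖ ^ 2 / L)) := by
          gcongr
          refine hcs.trans ?_
          gcongr
          rw [le_div_iff₀ hL, mul_comm]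
          exact hφ a
      _ = _ := by ring
  have hsplit := norm_sq_eq_norm_timeProj_sq_add hΩ (fourierL2 f)
  rw [norm_fourierL2] at hsplit
  rw [inner_timeFreqOp, hfT, inner_self_eq_norm_sq_to_K]
  have : (((‖timeProj hΩ (fourierL2 f)‖ : ℝ) : ℂ) ^ 2).re = ‖timeProj hΩ (fourierL2 f)‖ ^ 2 := by
    rw [← Complex.ofReal_pow, Complex.ofReal_re]
  refine le_trans ?_ this.ge
  linarith

theorem norm_fourierL2_sub_timeProj_le {Ω : Set ℝ} (hΩ : MeasurableSet Ω) {f f₀ : L2R}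
    (hf : Integrable (f : ℝ → ℂ)) (hf₀ : Integrable (f₀ : ℝ → ℂ)) {q : ℝ} (hq : 0 ≤ q)
    (h : ∀ ξ ∉ Ω, ‖𝓕 (f : ℝ → ℂ) ξ‖ ≤ q * ‖𝓕 (f₀ : ℝ → ℂ) ξ‖) :
    ‖fourierL2 f - timeProj hΩ (fourierL2 f)‖ ≤ q * ‖f₀‖ := by
  rw [← norm_fourierL2 f₀]
  refine Lp.norm_le_mul_norm_of_ae_le_mul ?_
  filter_upwards [fourierL2_coeFn hf, fourierL2_coeFn hf₀, timeProj_coeFn hΩ (fourierL2 f),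
    Lp.coeFn_sub (fourierL2 f) (timeProj hΩ (fourierL2 f))] with ξ h1 h2 h3 h4
  rw [h4, Pi.sub_apply, h3]
  by_cases hξ : ξ ∈ Ω
  · rw [Set.indicator_of_mem hξ, sub_self, norm_zero]
    positivity
  · rw [Set.indicator_of_notMem hξ, sub_zero, h1, h2]
    exact h ξ hξ

/-- The exponentials `exp (2πi (ν + k / L) x)` are orthogonal on every interval of length `L`. -/
theorem intervalIntegral_exp_sub {L : ℝ} (hL : 0 < L) (x₀ : ℝ) (j k : ℤ) :
    ∫ x in (x₀ - L / 2)..(x₀ + L / 2), Complex.exp (2 * pi * Complex.I * ((k - j) / L) * x) =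
      if j = k then (L : ℂ) else 0 := by
  split_ifs with h
  · subst h
    simp
  · have hkj : ((k : ℂ) - j) ≠ 0 := by
      exact sub_ne_zero.2 fun h' => h (by exact_mod_cast h'.symm)
    have hLC : (L : ℂ) ≠ 0 := by exact_mod_cast hL.ne'
    have hc : (2 * pi * Complex.I * ((k - j) / L) : ℂ) ≠ 0 :=
      mul_ne_zero Complex.two_pi_I_ne_zero (div_ne_zero hkj hLC)
    rw [integral_exp_mul_complex hc, div_eq_zero_iff]
    left
    rw [sub_eq_zero, Complex.exp_eq_exp_iff_exists_int]
    refine ⟨k - j, ?_⟩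
    push_cast
    field_simp
    ring

/-- The Riesz lower bound for modulated windows: on the plateau of the window the sum is a
trigonometric polynomial, to which Parseval's identity applies. -/
theorem mul_sum_sq_le_norm_sq {n : ℕ} {g : ℝ → ℂ} {x₀ ν L : ℝ} (hL : 0 < L)
    (h1 : ∀ x, |x - x₀| ≤ L / 2 → g x = 1) (φ : Fin n → L2R)
    (hφ : ∀ k, (φ k : ℝ → ℂ) =ᵐ[volume]
      fun x => Real.fourierChar ((ν + (k : ℕ) / L) * x) • g x) (a : Fin n → ℂ) :
    L * ∑ k, ‖a k‖ ^ 2 ≤ ‖∑ k, a k • φ k‖ ^ 2 := by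
  set J : Set ℝ := Set.Ioc (x₀ - L / 2) (x₀ + L / 2) with hJdef
  have hJ : MeasurableSet J := measurableSet_Ioc
  have hinner : ∀ j k, inner ℂ (timeProj hJ (φ j)) (timeProj hJ (φ k)) =
      if j = k then (L : ℂ) else 0 := by
    intro j k
    have := intervalIntegral_exp_sub hL x₀ (j : ℕ) (k : ℕ)
    rw [intervalIntegral.integral_of_le (by linarith), ← integral_indicator measurableSet_Ioc] at this
    rw [L2.inner_def]
    refine Eq.trans (integral_congr_ae ?_) (this.trans ?_)
    · filter_upwards [timeProj_coeFn hJ (φ j), timeProj_coeFn hJ (φ k), hφ j, hφ k]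
        with x h2 h3 h4 h5
      rw [h2, h3]
      by_cases hx : x ∈ J
      · have hg : g x = 1 := h1 x (abs_le.2 ⟨by linarith [hx.1], by linarith [hx.2]⟩)
        rw [Set.indicator_of_mem hx, Set.indicator_of_mem hx, Set.indicator_of_mem hx, h4, h5, hg]
        simp only [Circle.smul_def, Real.fourierChar_apply, smul_eq_mul, mul_one, RCLike.inner_apply,
          ← Complex.exp_conj, ← Complex.exp_add, map_mul, Complex.conj_I, Complex.conj_ofReal]
        congr 1
        push_cast
        ring
      · simp only [Set.indicator_of_notMem hx, inner_zero_left]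
        exact (Set.indicator_of_notMem hx _).symm
    · simp [Fin.ext_iff]
  have hsq : ‖∑ k, a k • timeProj hJ (φ k)‖ ^ 2 = L * ∑ k, ‖a k‖ ^ 2 := by
    have : ((‖∑ k, a k • timeProj hJ (φ k)‖ : ℝ) : ℂ) ^ 2 = ((L * ∑ k, ‖a k‖ ^ 2 : ℝ) : ℂ) := by
      refine (inner_self_eq_norm_sq_to_K (𝕜 := ℂ)
        (∑ k, a k • timeProj hJ (φ k))).symm.trans ?_
      rw [sum_inner]
      simp only [inner_sum, inner_smul_left, inner_smul_right, hinner]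
      push_cast
      rw [Finset.mul_sum]
      refine Finset.sum_congr rfl fun j _ => ?_
      simp only [mul_ite, mul_zero, Finset.sum_ite_eq, Finset.mem_univ, if_true]
      rw [← Complex.conj_mul']
      ring
    exact_mod_cast this
  have hle := norm_sq_eq_norm_timeProj_sq_add hJ (∑ k, a k • φ k)
  have hmap : timeProj hJ (∑ k, a k • φ k) = ∑ k, a k • timeProj hJ (φ k) := by simp
  rw [hmap, hsq] at hle
  nlinarith [sq_nonneg ‖∑ k, a k • φ k - ∑ k, a k • timeProj hJ (φ k)‖]

end TrialFunctions

/-! ### The lower bound for a given pair of intervals -/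

section MainEstimate

open scoped FourierTransform
open Real (pi)

/-- The lower bound obtained from modulated windows with frequencies `ν + k / L`, `k < n`, all at
distance at least `d` from the complement of `Ω`. -/
theorem one_sub_le_nthEigenvalue {T Ω : Set ℝ} (hT : MeasurableSet T) (hΩ : MeasurableSet Ω)
    (hTb : Bornology.IsBounded T) (hΩb : Bornology.IsBounded Ω) {n m : ℕ} (hn : 0 < n)
    {x₀ r R w L ν d : ℝ} (hL : 0 < L) (hr : 0 < r) (hrR : r < R) (hw : 0 < w)
    (hrL : L / 2 ≤ r - m * (w / 2)) (hwd : 2 ≤ pi * w * d)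
    (hTball : ∀ x, |x - x₀| ≤ R + m * (w / 2) → x ∈ T)
    (hΩfar : ∀ ξ ∉ Ω, ∀ k < n, d ≤ |ξ - (ν + k / L)|) :
    1 - (1 / 4) ^ m * (2 * R) * n / L ≤ nthEigenvalue (timeFreqOp hT hΩ) n := by
  obtain ⟨g, g₀, hg, h1, h0, hg₀, hb₀, h0₀, hF⟩ := exists_window x₀ hr hrR hw m
  have hmod : ∀ {h : ℝ → ℂ} (_ : Continuous h) {ρ : ℝ} (_ : ∀ x, ρ < |x - x₀| → h x = 0) (κ : ℝ),
      Continuous (fun x => Real.fourierChar (κ * x) • h x) ∧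
        HasCompactSupport (fun x => Real.fourierChar (κ * x) • h x) := by
    intro h hh ρ hρ κ
    refine ⟨?_, hasCompactSupport_of_eq_zero (R := ρ) fun x hx => by rw [hρ x hx, smul_zero]⟩
    exact (Real.continuous_fourierChar.comp (continuous_const.mul continuous_id)).smul hh
  have hL2 : ∀ k : Fin n, MemLp (fun x => Real.fourierChar ((ν + (k : ℕ) / L) * x) • g x) 2
      volume := fun k => (hmod hg h0 _).1.memLp_of_hasCompactSupport (hmod hg h0 _).2
  have hL2₀ : ∀ k : Fin n, MemLp (fun x => Real.fourierChar ((ν + (k : ℕ) / L) * x) • g₀ x) 2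
      volume := fun k => (hmod hg₀ h0₀ _).1.memLp_of_hasCompactSupport (hmod hg₀ h0₀ _).2
  have hint : ∀ k, Integrable ((hL2 k).toLp : ℝ → ℂ) := fun k =>
    ((hmod hg h0 _).1.integrable_of_hasCompactSupport (hmod hg h0 _).2).congr
      (hL2 k).coeFn_toLp.symm
  have hint₀ : ∀ k, Integrable ((hL2₀ k).toLp : ℝ → ℂ) := fun k =>
    ((hmod hg₀ h0₀ _).1.integrable_of_hasCompactSupport (hmod hg₀ h0₀ _).2).congr
      (hL2₀ k).coeFn_toLp.symm
  have hR : 0 < R := hr.trans hrR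
  have hnorm₀ : ∀ k, ‖(hL2₀ k).toLp‖ ≤ (2 * R) ^ (1 / 2 : ℝ) := by
    intro k
    have := norm_le_of_ae_le_indicator (measurableSet_closedBall (x := x₀) (ε := R))
      measure_closedBall_lt_top.ne zero_le_one (h := (hL2₀ k).toLp) (by
        filter_upwards [(hL2₀ k).coeFn_toLp] with x hx
        rw [hx, Circle.norm_smul]
        by_cases hxR : |x - x₀| ≤ R
        · rw [Set.indicator_of_mem (by simpa [Real.dist_eq] using hxR)]
          exact hb₀ x
        · rw [h0₀ x (not_le.1 hxR), norm_zero]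
          exact Set.indicator_nonneg (fun _ _ => zero_le_one) _)
    rwa [one_mul, Real.volume_closedBall, ENNReal.toReal_ofReal (by positivity)] at this
  have hkey := le_nthEigenvalue_timeFreqOp hT hΩ hTb hΩb hn (fun k => (hL2 k).toLp)
    (η := (1 / 2) ^ m * (2 * R) ^ (1 / 2 : ℝ)) hL ?_ ?_ (mul_sum_sq_le_norm_sq (ν := ν) hL
      (fun x hx => h1 x (hx.trans hrL)) _ fun k => (hL2 k).coeFn_toLp)
  · convert hkey using 3
    rw [mul_pow, ← Real.sqrt_eq_rpow, Real.sq_sqrt (by positivity), ← pow_mul, mul_comm m 2, pow_mul]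
    norm_num
  · intro k
    refine Lp.ext ?_
    filter_upwards [timeProj_coeFn hT (hL2 k).toLp, (hL2 k).coeFn_toLp] with x h2 h3
    rw [h2]
    by_cases hx : x ∈ T
    · rw [Set.indicator_of_mem hx]
    · rw [Set.indicator_of_notMem hx, h3, h0 x (not_le.1 fun h => hx (hTball x h)), smul_zero]
  · intro k
    refine (norm_fourierL2_sub_timeProj_le hΩ (hint k) (hint₀ k) (q := (1 / 2) ^ m) (by positivity)
      fun ξ hξ => ?_).trans (mul_le_mul_of_nonneg_left (hnorm₀ k) (by positivity))
    rw [Real.fourier_congr_ae (hL2 k).coeFn_toLp, Real.fourier_congr_ae (hL2₀ k).coeFn_toLp,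
      fourier_fourierChar_smul, fourier_fourierChar_smul]
    set ζ := ξ - (ν + (k : ℕ) / L)
    have hζ : 2 ≤ pi * w * |ζ| := hwd.trans
      (mul_le_mul_of_nonneg_left (hΩfar ξ hξ k k.2) (by have := Real.pi_pos; positivity))
    have h2 : 2 ^ m * ‖𝓕 g ζ‖ ≤ ‖𝓕 g₀ ζ‖ :=
      (mul_le_mul_of_nonneg_right (pow_le_pow_left₀ zero_le_two hζ m) (norm_nonneg _)).trans (hF ζ)
    rw [one_div, inv_pow, inv_mul_eq_div, le_div_iff₀ (by positivity), mul_comm]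
    exact h2

/-- An interval of positive finite length agrees with an open interval up to endpoints. -/
theorem exists_Ioo_subset_of_ordConnected {T : Set ℝ} (hT : T.OrdConnected)
    (h0 : volume T ≠ 0) (hfin : volume T ≠ ⊤) :
    ∃ a b, a < b ∧ Set.Ioo a b ⊆ T ∧ T ⊆ Set.Icc a b ∧ volume T = ENNReal.ofReal (b - a) := by
  obtain ⟨x, hx⟩ := nonempty_of_measure_ne_zero h0
  have hdist : ∀ y ∈ T, ∀ z ∈ T, z - y ≤ (volume T).toReal := fun y hy z hz => by
    have h := measure_mono (μ := volume) (hT.out hy hz)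
    rw [Real.volume_Icc] at h
    exact (ENNReal.ofReal_le_iff_le_toReal hfin).1 h
  have hbelow : BddBelow T := ⟨x - (volume T).toReal, fun y hy => by linarith [hdist y hy x hx]⟩
  have habove : BddAbove T := ⟨x + (volume T).toReal, fun y hy => by linarith [hdist x hx y hy]⟩
  have hsub1 : Set.Ioo (sInf T) (sSup T) ⊆ T :=
    IsConnected.Ioo_csInf_csSup_subset ⟨⟨x, hx⟩, hT.isPreconnected⟩
     hbelow habove
  have hsub2 : T ⊆ Set.Icc (sInf T) (sSup T) := fun y hy => ⟨csInf_le hbelow hy, le_csSup habove hy⟩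
  have hvol : volume T = ENNReal.ofReal (sSup T - sInf T) :=
    le_antisymm ((measure_mono hsub2).trans_eq Real.volume_Icc)
      (Real.volume_Ioo.symm.trans_le (measure_mono hsub1))
  refine ⟨sInf T, sSup T, ?_, hsub1, hsub2, hvol⟩
  by_contra! h
  exact h0 (by rw [hvol, ENNReal.ofReal_eq_zero]; linarith)

/-- The exponential gain absorbs the polynomial loss. -/
theorem exists_eight_mul_rpow_le_one {δ : ℝ} (h0 : 0 < δ) (h1 : δ < 1) :
    ∃ c₀ : ℝ, ∀ c, c₀ ≤ c → 8 * c * δ ^ c ≤ 1 := by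
  have h := (tendsto_rpow_mul_exp_neg_mul_atTop_nhds_zero 1 (-Real.log δ)
    (neg_pos.2 (Real.log_neg h0 h1))).const_mul 8
  rw [mul_zero] at h
  obtain ⟨c₀, hc₀⟩ := Filter.eventually_atTop.1 (h.eventually_le_const one_pos)
  refine ⟨c₀, fun c hc => (hc₀ c hc).trans_eq' ?_⟩
  rw [Real.rpow_def_of_pos h0, Real.rpow_one, neg_neg, mul_assoc]

/-- For `T` of length `ℓ` and `Ω` of length `W`, a plateau of length `(1 - ε / 2) ℓ` and frequency
margins `ε W / 4` leave room for `[(1 - ε) ℓ W]` trial functions, whose windows are averaged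
`[ε² ℓ W / 32]` times. -/
theorem one_sub_le_nthEigenvalue_of_Ioo_subset {ε : ℝ} (hε : 0 < ε) (hε1 : ε < 1) {T Ω : Set ℝ}
    (hT : MeasurableSet T) (hΩ : MeasurableSet Ω) {x₁ x₂ ω₁ ω₂ c : ℝ} (hx : x₁ < x₂) (hω : ω₁ < ω₂)
    (hT1 : Set.Ioo x₁ x₂ ⊆ T) (hT2 : T ⊆ Set.Icc x₁ x₂) (hΩ1 : Set.Ioo ω₁ ω₂ ⊆ Ω)
    (hΩ2 : Ω ⊆ Set.Icc ω₁ ω₂) (hc : (x₂ - x₁) * (ω₂ - ω₁) = c) (hn : 0 < ⌊(1 - ε) * c⌋₊) :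
    1 - (1 / 4) ^ ⌊ε ^ 2 / 32 * c⌋₊ * (2 * c) ≤
      nthEigenvalue (timeFreqOp hT hΩ) ⌊(1 - ε) * c⌋₊ := by
  set ℓ := x₂ - x₁ with hℓ
  set W := ω₂ - ω₁ with hW
  have hℓ0 : 0 < ℓ := sub_pos.2 hx
  have hW0 : 0 < W := sub_pos.2 hω
  have hc0 : 0 < c := hc ▸ mul_pos hℓ0 hW0
  set n := ⌊(1 - ε) * c⌋₊
  set m := ⌊ε ^ 2 / 32 * c⌋₊
  have hnc : (n : ℝ) ≤ (1 - ε) * c := Nat.floor_le (by nlinarith)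
  have hmc : (m : ℝ) ≤ ε ^ 2 / 32 * c := Nat.floor_le (by positivity)
  have hL0 : 0 < (1 - ε / 2) * ℓ := mul_pos (by linarith) hℓ0
  have hmw : m * (4 / (ε * W) / 2) ≤ ε * ℓ / 16 := by
    calc m * (4 / (ε * W) / 2) ≤ ε ^ 2 / 32 * c * (4 / (ε * W) / 2) := by gcongr
      _ = _ := by rw [← hc]; field_simp; ring
  -- With `w = 4 / (ε W)` and `d = ε W / 4` one has `π w d = π ≥ 2`. The gap `ε ℓ / 4` on each side
  -- of the plateau holds two enlargements by `m w / 2 ≤ ε ℓ / 16`, the slope of the bump, of width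
  -- `ε ℓ / 16`, and `ε ℓ / 16` to spare.
  have hkey := one_sub_le_nthEigenvalue hT hΩ ((Metric.isBounded_Icc x₁ x₂).subset hT2)
    ((Metric.isBounded_Icc ω₁ ω₂).subset hΩ2) (n := n) (m := m) hn (x₀ := (x₁ + x₂) / 2)
    (r := (1 - ε / 2) * ℓ / 2 + ε * ℓ / 16) (R := (1 - ε / 2) * ℓ / 2 + ε * ℓ / 8)
    (w := 4 / (ε * W)) (L := (1 - ε / 2) * ℓ) (ν := ω₁ + ε * W / 4) (d := ε * W / 4)
    hL0 (by positivity) (by nlinarith) (by positivity) (by linarith) ?_ ?_ ?_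
  · refine le_trans ?_ hkey
    have h1 : 2 * ((1 - ε / 2) * ℓ / 2 + ε * ℓ / 8) ≤ ℓ := by nlinarith
    have h2 : (n : ℝ) ≤ c := hnc.trans (by nlinarith)
    have h3 : ℓ / 2 ≤ (1 - ε / 2) * ℓ := by nlinarith
    have : (1 / 4 : ℝ) ^ m * (2 * ((1 - ε / 2) * ℓ / 2 + ε * ℓ / 8)) * n / ((1 - ε / 2) * ℓ) ≤
        (1 / 4) ^ m * ℓ * c / (ℓ / 2) := by gcongr
    have h4 : (1 / 4 : ℝ) ^ m * ℓ * c / (ℓ / 2) = (1 / 4) ^ m * (2 * c) := by field_simp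
    linarith
  · have : pi * (4 / (ε * W)) * (ε * W / 4) = pi := by field_simp
    rw [this]
    exact Real.two_le_pi
  · intro x hx
    have hεℓ : 0 < ε * ℓ := mul_pos hε hℓ0
    have h2 := abs_le.1 hx
    exact hT1 ⟨by nlinarith [h2.1], by nlinarith [h2.2]⟩
  · intro ξ hξ k hk
    have hk0 : (0 : ℝ) ≤ k / ((1 - ε / 2) * ℓ) := by positivity
    have hk1 : k / ((1 - ε / 2) * ℓ) ≤ (1 - ε / 2) * W := by
      rw [div_le_iff₀ hL0]
      have : (k : ℝ) ≤ n := by exact_mod_cast hk.le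
      have h2 : (1 - ε / 2) * W * ((1 - ε / 2) * ℓ) = (1 - ε / 2) ^ 2 * c := by rw [← hc]; ring
      rw [h2]
      nlinarith [mul_pos (pow_pos hε 2) hc0]
    rcases le_or_gt ξ ω₁ with h | h
    · rw [abs_sub_comm]
      exact le_trans (by linarith) (le_abs_self _)
    · have h' : ω₂ ≤ ξ := not_lt.1 fun h' => hξ (hΩ1 ⟨h, h'⟩)
      refine le_trans ?_ (le_abs_self _)
      nlinarith

end MainEstimate

/-- For `0 < ε < 1` there is `δ ∈ (0, 1)` such that for all large `c` and all intervals `T, Ω` with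
`|T| |Ω| = c`, the `n`-th eigenvalue of `P_T Q_Ω P_T` is at least `1 - δ ^ c`, `n = [(1 - ε) c]`. -/
theorem theorem4 (ε : ℝ) (hε : 0 < ε) (hε1 : ε < 1) :
    ∃ δ : ℝ, 0 < δ ∧ δ < 1 ∧ ∃ c₀ : ℝ, ∀ c : ℝ, c₀ ≤ c →
      ∀ (T Ω : Set ℝ) (hT : T.OrdConnected) (hΩ : Ω.OrdConnected),
        MeasureTheory.volume T * MeasureTheory.volume Ω = ENNReal.ofReal c →
        1 - δ ^ c ≤ nthEigenvalue (timeFreqOp hT.measurableSet hΩ.measurableSet)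
          ⌊(1 - ε) * c⌋₊ := by
  have hs : 0 < ε ^ 2 / 32 := by positivity
  have hδ0 : (0 : ℝ) < (1 / 2) ^ (ε ^ 2 / 32) := by positivity
  have hδ1 : (1 / 2 : ℝ) ^ (ε ^ 2 / 32) < 1 :=
    Real.rpow_lt_one (by norm_num) (by norm_num) hs
  obtain ⟨c₀, hc₀⟩ := exists_eight_mul_rpow_le_one hδ0 hδ1
  refine ⟨(1 / 2) ^ (ε ^ 2 / 32), hδ0, hδ1, max c₀ (1 / (1 - ε)), fun c hc T Ω hT hΩ hvol => ?_⟩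
  have h1ε : 0 < 1 - ε := sub_pos.2 hε1
  have hc1 : 1 ≤ (1 - ε) * c := by
    have := (le_max_right _ _).trans hc
    rwa [div_le_iff₀' h1ε] at this
  have hc0 : 0 < c := pos_of_mul_pos_right (one_pos.trans_le hc1) h1ε.le
  have hne : volume T * volume Ω ≠ 0 := by
    rw [hvol]; exact (ENNReal.ofReal_pos.2 hc0).ne'
  have hT0 := left_ne_zero_of_mul hne
  have hΩ0 := right_ne_zero_of_mul hne
  have hTf : volume T ≠ ⊤ := fun h => by
    rw [h, ENNReal.top_mul hΩ0] at hvol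
    exact ENNReal.ofReal_ne_top hvol.symm
  have hΩf : volume Ω ≠ ⊤ := fun h => by
    rw [h, ENNReal.mul_top hT0] at hvol
    exact ENNReal.ofReal_ne_top hvol.symm
  obtain ⟨x₁, x₂, hx, hT1, hT2, hTv⟩ := exists_Ioo_subset_of_ordConnected hT hT0 hTf
  obtain ⟨ω₁, ω₂, hω, hΩ1, hΩ2, hΩv⟩ := exists_Ioo_subset_of_ordConnected hΩ hΩ0 hΩf
  have hprod : (x₂ - x₁) * (ω₂ - ω₁) = c := by
    rw [hTv, hΩv, ← ENNReal.ofReal_mul (sub_pos.2 hx).le,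
      ENNReal.ofReal_eq_ofReal_iff (mul_pos (sub_pos.2 hx) (sub_pos.2 hω)).le hc0.le] at hvol
    exact hvol
  refine le_trans ?_ (one_sub_le_nthEigenvalue_of_Ioo_subset hε hε1 hT.measurableSet
    hΩ.measurableSet hx hω hT1 hT2 hΩ1 hΩ2 hprod (Nat.floor_pos.2 hc1))
  have hm := Nat.lt_floor_add_one (ε ^ 2 / 32 * c)
  set m := ⌊ε ^ 2 / 32 * c⌋₊
  set D : ℝ := ((1 / 2 : ℝ) ^ (ε ^ 2 / 32)) ^ c with hD
  -- Half of the exponential gain `D ^ 2` pays for the factor `8 c`, in which `4` comes from rounding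
  -- the number of averages down.
  have hpow : (1 / 4 : ℝ) ^ (m + 1) ≤ D ^ 2 := by
    have h1 : D ^ 2 = (1 / 4 : ℝ) ^ (ε ^ 2 / 32 * c) := by
      rw [hD, ← Real.rpow_mul (by norm_num), ← Real.rpow_natCast, ← Real.rpow_mul (by norm_num),
        show (1 / 4 : ℝ) = (1 / 2) ^ (2 : ℝ) by norm_num, ← Real.rpow_mul (by norm_num)]
      congr 1
      push_cast
      ring
    rw [h1, ← Real.rpow_natCast]
    exact Real.rpow_le_rpow_of_exponent_ge (by norm_num) (by norm_num) (by push_cast; exact hm.le)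
  have hDc : 8 * c * D ≤ 1 := hc₀ c ((le_max_left _ _).trans hc)
  have hD0 : 0 < D := by positivity
  have : (1 / 4 : ℝ) ^ m * (2 * c) ≤ D := by
    calc (1 / 4 : ℝ) ^ m * (2 * c) = (1 / 4 : ℝ) ^ (m + 1) * (8 * c) := by ring
      _ ≤ D ^ 2 * (8 * c) := by gcongr
      _ = D * (8 * c * D) := by ring
      _ ≤ D * 1 := by gcongr
      _ = D := mul_one D
  linarith
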